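/- Let $D,d,q,N\in\mathbb N$ with $N\ge 1$ and $D>qN$ (the overparameterized setting). Let $\Phi:\mathbb R^D\times\mathbb R^d\to\mathbb R^q$ be a network function, let $(x_i,y_i)\in\mathbb R^d\times\mathbb R^q$, $1\le i\le N$, be training data, and let $\ell:\mathbb R^q\times\mathbb R^q\to[0,\infty)$ satisfy $\ell(y',y)=0$ if and only if $y'=y$. Let $$\mathcal L(\theta)=\frac1N\sum_{i=1}^N\ell(\Phi(\theta,x_i),y_i),\qquad \varphi(\theta)=\theta-\eta\nabla\mathcal L(\theta),\qquad \mathcal M=\{\theta\in\mathbb R^D:\mathcal L(\theta)=0\}$$ be the loss function, the gradient descent map with learning rate $\eta>0$, and the set of global minima (interpolation solutions). Assume that $\mathcal L$ is twice continuously differentiable and that $\mathcal M$ is a $(D-qN)$-dimensional embedded ($C^1$) submanifold of $\mathbb R^D$. For $\theta^*\in\mathcal M$ let $\mathcal T(\theta^*)$ be the tangent space of $\mathcal M$ at $\theta^*$ and $\mathcal N(\theta^*)=\mathcal T(\theta^*)^\perp$ the normal space. Call $\theta^*\in\mathcal M$ locally stable if for every open neighborhood $U\subset\mathbb R^D$ of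 $\theta^*$ and every neighborhood $V\subset\mathcal M$ of $\theta^*$ that is open in the topology of $\mathcal M$, $$\operatorname{Vol}\Bigl\{\theta\in\mathbb R^D:\ \varphi^n(\theta)\in U\ \text{ for all } n\ge 0,\ \text{ and }\ \lim_{n\to\infty}\varphi^n(\theta)=\theta'\ \text{ for some } \theta'\in V\Bigr\}>0 .$$ Theorem. For every $\theta^*\in\mathcal M$, the Jacobian $\mathrm D\varphi(\theta^*)$ maps $\mathcal N(\theta^*)$ into itself, and, with $\rho$ denoting the spectral radius, $\theta^*$ is locally stable if $\rho(\mathrm D\varphi(\theta^*)|_{\mathcal N(\theta^*)})<1$, and only if $\rho(\mathrm D\varphi(\theta^*)|_{\mathcal N(\theta^*)})\le 1$. -/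

import Mathlib

open Filter Topology MeasureTheory
open scoped ENNReal

noncomputable section

/-- The empirical loss `ℒ(θ) = (1/N) ∑ᵢ ℓ(Φ(θ, xᵢ), yᵢ)` of a network function `Φ` with pointwise
loss `ℓ` on the training data `(xᵢ, yᵢ)`. -/
def empiricalLoss {D d q N : ℕ}
    (Φ : EuclideanSpace ℝ (Fin D) → EuclideanSpace ℝ (Fin d) → EuclideanSpace ℝ (Fin q))
    (ℓ : EuclideanSpace ℝ (Fin q) → EuclideanSpace ℝ (Fin q) → ℝ)
    (x : Fin N → EuclideanSpace ℝ (Fin d)) (y : Fin N → EuclideanSpace ℝ (Fin q))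
    (θ : EuclideanSpace ℝ (Fin D)) : ℝ :=
  (1 / (N : ℝ)) * ∑ i, ℓ (Φ θ (x i)) (y i)

/-- The set `ℳ = {θ | ℒ(θ) = 0}` of interpolation solutions. -/
def interpolationSet {D : ℕ} (L : EuclideanSpace ℝ (Fin D) → ℝ) :
    Set (EuclideanSpace ℝ (Fin D)) :=
  {θ | L θ = 0}

/-- The gradient descent update map `φ(θ) = θ - η ∇ℒ(θ)` with learning rate `η`. -/
def gradientDescentMap {D : ℕ} (η : ℝ) (L : EuclideanSpace ℝ (Fin D) → ℝ)
    (θ : EuclideanSpace ℝ (Fin D)) : EuclideanSpace ℝ (Fin D) :=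
  θ - η • gradient L θ

/-- `M ⊆ ℝ^D` is a `k`-dimensional embedded (`C¹`) submanifold: around each of its points there is
a `C¹` diffeomorphism `e` between open subsets of `ℝ^D` that flattens `M`, i.e. takes the points of
`M` in its source to the points of its target whose last `D - k` coordinates vanish. -/
def IsEmbeddedSubmanifold {D : ℕ} (k : ℕ) (M : Set (EuclideanSpace ℝ (Fin D))) : Prop :=
  k ≤ D ∧ ∀ p ∈ M,
    ∃ e : OpenPartialHomeomorph (EuclideanSpace ℝ (Fin D)) (EuclideanSpace ℝ (Fin D)),
      p ∈ e.source ∧ ContDiffOn ℝ 1 e e.source ∧ ContDiffOn ℝ 1 e.symm e.target ∧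
        ∀ z ∈ e.source, z ∈ M ↔ ∀ i : Fin D, k ≤ (i : ℕ) → e z i = 0

/-- The tangent space `𝒯(p)` of `M ⊆ ℝ^D` at `p`, spanned by the velocities `γ'(0)` of the curves
`γ` in `M` with `γ(0) = p`. (For an embedded submanifold these velocities already form a linear
subspace.) -/
def tangentSpaceAt {D : ℕ} (M : Set (EuclideanSpace ℝ (Fin D))) (p : EuclideanSpace ℝ (Fin D)) :
    Submodule ℝ (EuclideanSpace ℝ (Fin D)) :=
  Submodule.span ℝ {v | ∃ γ : ℝ → EuclideanSpace ℝ (Fin D),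
    γ 0 = p ∧ (∀ᶠ t in 𝓝 (0 : ℝ), γ t ∈ M) ∧ HasDerivAt γ v 0}

/-- The normal space `𝒩(p) = 𝒯(p)^⊥`. -/
def normalSpaceAt {D : ℕ} (M : Set (EuclideanSpace ℝ (Fin D))) (p : EuclideanSpace ℝ (Fin D)) :
    Submodule ℝ (EuclideanSpace ℝ (Fin D)) :=
  (tangentSpaceAt M p)ᗮ

/-- The spectral radius of a real linear endomorphism: the supremum of `|μ|` over the complex
spectrum, i.e. over the spectrum of its complexification. -/
def realSpectralRadius {V : Type*} [AddCommGroup V] [Module ℝ V] (f : V →ₗ[ℝ] V) : ℝ≥0∞ :=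
  spectralRadius ℂ (f.baseChange ℂ : Module.End ℂ (TensorProduct ℝ ℂ V))

/-- Local stability of `p ∈ M` under iteration of `φ`: for every open neighbourhood `U` of `p` and
every neighbourhood `V` of `p` open in the (subspace) topology of `M`, the set of initial points
whose orbit stays in `U` forever and converges to some point of `V` has positive Lebesgue
measure. -/
def IsLocallyStable {D : ℕ} (φ : EuclideanSpace ℝ (Fin D) → EuclideanSpace ℝ (Fin D))
    (M : Set (EuclideanSpace ℝ (Fin D))) (p : M) : Prop :=
  ∀ U : Set (EuclideanSpace ℝ (Fin D)), IsOpen U → (p : EuclideanSpace ℝ (Fin D)) ∈ U →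
    ∀ V : Set M, IsOpen V → p ∈ V →
      0 < volume {θ : EuclideanSpace ℝ (Fin D) | (∀ n : ℕ, φ^[n] θ ∈ U) ∧
        ∃ θ' ∈ V, Tendsto (fun n : ℕ => φ^[n] θ) atTop (𝓝 (θ' : EuclideanSpace ℝ (Fin D)))}

end

/-! Let `g = ∇L` and let `H` be the Hessian at `p ∈ M`. As `L ≥ 0`, `g` vanishes on `M`, so the
symmetric map `H` kills the tangent space and has range in the normal space `N`. Hence `Dφ = 1 - ηH`
is symmetric and preserves `N`.

If the spectral radius on `N` is below 1, `Dφ` contracts `N` in norm and `H` is bounded below there.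
Every `θ` near `p` lies in a slice `z + N` with `z ∈ M` near `p`, so `g θ ≈ H (θ - z)` and each step
shrinks `‖g‖` by a fixed factor. Whole orbits therefore converge geometrically to points of `M`
(`eventually_iterate_mem_and_tendsto`).

If it exceeds 1, a quadratic form, positive along an expanded eigenvector `v`, grows on differences
of orbits near `p`. Two trapped orbits thus never start at points differing by a nonzero multiple of
`v`, so the trapped set has infinitely many disjoint translates and is null
(`exists_measure_iterate_mem_closedBall_eq_zero`). No invariant manifold or invertibility of `φ` is
needed. -/

theorem HasStrictFDerivAt.exists_ball_norm_sub_le {E F : Type*} [NormedAddCommGroup E]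
    [NormedSpace ℝ E] [NormedAddCommGroup F] [NormedSpace ℝ F] {g : E → F} {H : E →L[ℝ] F} {p : E}
    (hg : HasStrictFDerivAt g H p) {ε : ℝ} (hε : 0 < ε) :
    ∃ r > 0, ∀ a ∈ Metric.ball p r, ∀ b ∈ Metric.ball p r,
      ‖g a - g b - H (a - b)‖ ≤ ε * ‖a - b‖ := by
  obtain ⟨r, hr, h⟩ := Metric.eventually_nhds_iff.1 (hg.isLittleO.def hε)
  refine ⟨r, hr, fun a ha b hb => h (y := (a, b)) ?_⟩
  rw [Prod.dist_eq]
  exact max_lt ha hb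

/-! ### Expanding directions: the trapped set is null. -/

section Unstable

variable {E : Type*} [NormedAddCommGroup E] [InnerProductSpace ℝ E]

/-- The quadratic form `‖Aw‖² - c‖w‖²`, positive on a cone around the directions that `A` expands
by more than `√c`. -/
def expansionForm (A : E →L[ℝ] E) (c : ℝ) (w : E) : ℝ := ‖A w‖ ^ 2 - c * ‖w‖ ^ 2

/-- Symmetry turns the cross term `⟪A (A w), w⟫` into `‖A w‖ ^ 2`, which completes the square. -/
theorem expansionForm_apply_of_isSymmetric {A : E →L[ℝ] E} (hA : A.toLinearMap.IsSymmetric)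
    (c : ℝ) (w : E) :
    expansionForm A c (A w) = c * expansionForm A c w + ‖A (A w) - c • w‖ ^ 2 := by
  have h : inner ℝ (A (A w)) w = ‖A w‖ ^ 2 := by
    rw [← real_inner_self_eq_norm_sq]; exact hA (A w) w
  rw [@norm_sub_sq_real, inner_smul_right, h, norm_smul, mul_pow, Real.norm_eq_abs, sq_abs]
  simp only [expansionForm]
  ring

/-- The square left over in the linear identity is at least `δ * ‖w‖ ^ 2`, which absorbs the
perturbation. The three terms in `hεδ` pay for the two cross terms and for `c * ‖r‖ ^ 2`. -/
theorem expansionForm_le_of_norm_sub_le {A : E →L[ℝ] E} (hA : A.toLinearMap.IsSymmetric)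
    {c δ ε : ℝ} (hc : 0 ≤ c) (hε : 0 ≤ ε) (hε1 : ε ≤ 1)
    (hδ : ∀ w, δ * ‖w‖ ^ 2 ≤ ‖A (A w) - c • w‖ ^ 2)
    (hεδ : ε * (2 * ‖A‖ ^ 3 + 2 * c * ‖A‖ + c) ≤ δ) {w w' : E} (hw : ‖w' - A w‖ ≤ ε * ‖w‖) :
    c * expansionForm A c w ≤ expansionForm A c w' := by
  obtain ⟨r, rfl⟩ : ∃ r, w' = A w + r := ⟨w' - A w, by abel⟩
  rw [add_sub_cancel_left] at hw
  have hQ := expansionForm_apply_of_isSymmetric hA c w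
  have hd := hδ w
  have hAw : ‖A w‖ ≤ ‖A‖ * ‖w‖ := A.le_opNorm w
  have hAAw : ‖A (A w)‖ ≤ ‖A‖ * (‖A‖ * ‖w‖) :=
    (A.le_opNorm _).trans (mul_le_mul_of_nonneg_left hAw (norm_nonneg _))
  have hAr : ‖A r‖ ≤ ‖A‖ * (ε * ‖w‖) :=
    (A.le_opNorm _).trans (mul_le_mul_of_nonneg_left hw (norm_nonneg _))
  have h1 : ‖A (A w + r)‖ ^ 2 = ‖A (A w)‖ ^ 2 + 2 * inner ℝ (A (A w)) (A r) + ‖A r‖ ^ 2 := by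
    rw [map_add, @norm_add_sq_real]
  have h2 : ‖A w + r‖ ^ 2 = ‖A w‖ ^ 2 + 2 * inner ℝ (A w) r + ‖r‖ ^ 2 := by
    rw [@norm_add_sq_real]
  have h3 : -(‖A‖ * (‖A‖ * ‖w‖) * (‖A‖ * (ε * ‖w‖))) ≤ inner ℝ (A (A w)) (A r) :=
    (neg_le_neg (mul_le_mul hAAw hAr (norm_nonneg _) (by positivity))).trans
      (neg_le_of_abs_le (abs_real_inner_le_norm _ _))
  have h4 : inner ℝ (A w) r ≤ ‖A‖ * ‖w‖ * (ε * ‖w‖) :=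
    (real_inner_le_norm _ _).trans (mul_le_mul hAw hw (norm_nonneg _) (by positivity))
  have h5 : ‖r‖ ^ 2 ≤ ε * ‖w‖ ^ 2 := by
    calc ‖r‖ ^ 2 ≤ (ε * ‖w‖) ^ 2 := pow_le_pow_left₀ (norm_nonneg _) hw 2
      _ = ε * (ε * ‖w‖ ^ 2) := by ring
      _ ≤ 1 * (ε * ‖w‖ ^ 2) := mul_le_mul_of_nonneg_right hε1 (by positivity)
      _ = ε * ‖w‖ ^ 2 := one_mul _
  have h6 := mul_le_mul_of_nonneg_right hεδ (sq_nonneg ‖w‖)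
  have h7 := mul_le_mul_of_nonneg_left h4 hc
  have h8 := mul_le_mul_of_nonneg_left h5 hc
  simp only [expansionForm] at hQ ⊢
  rw [h1, h2]
  nlinarith [sq_nonneg ‖A r‖]

theorem expansionForm_sub_nonpos_of_iterate_mem_closedBall {A : E →L[ℝ] E} {φ : E → E} {p : E}
    {c r : ℝ} (hc : 1 < c)
    (hstep : ∀ a ∈ Metric.closedBall p r, ∀ b ∈ Metric.closedBall p r,
      c * expansionForm A c (a - b) ≤ expansionForm A c (φ a - φ b))
    {a b : E} (ha : ∀ n, φ^[n] a ∈ Metric.closedBall p r)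
    (hb : ∀ n, φ^[n] b ∈ Metric.closedBall p r) :
    expansionForm A c (a - b) ≤ 0 := by
  by_contra! hpos
  have hgrow : ∀ n, c ^ n * expansionForm A c (a - b) ≤
      expansionForm A c (φ^[n] a - φ^[n] b) := by
    intro n
    induction n with
    | zero => simp
    | succ n ih =>
      rw [Function.iterate_succ_apply', Function.iterate_succ_apply', pow_succ']
      calc c * c ^ n * expansionForm A c (a - b)
          = c * (c ^ n * expansionForm A c (a - b)) := by ring
        _ ≤ c * expansionForm A c (φ^[n] a - φ^[n] b) :=
          mul_le_mul_of_nonneg_left ih (by linarith)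
        _ ≤ _ := hstep _ (ha n) _ (hb n)
  have hbdd : ∀ n, expansionForm A c (φ^[n] a - φ^[n] b) ≤ (‖A‖ * (r + r)) ^ 2 := by
    intro n
    have h1 : ‖φ^[n] a - φ^[n] b‖ ≤ r + r := by
      rw [← dist_eq_norm]
      exact (dist_triangle_right _ _ p).trans (add_le_add (ha n) (hb n))
    have h2 : ‖A (φ^[n] a - φ^[n] b)‖ ≤ ‖A‖ * (r + r) :=
      (A.le_opNorm _).trans (mul_le_mul_of_nonneg_left h1 (norm_nonneg _))
    have h3 := pow_le_pow_left₀ (norm_nonneg _) h2 2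
    have h4 : 0 ≤ c * ‖φ^[n] a - φ^[n] b‖ ^ 2 := mul_nonneg (by linarith) (sq_nonneg _)
    simp only [expansionForm]
    linarith
  obtain ⟨n, hn⟩ := ((tendsto_pow_atTop_atTop_of_one_lt hc).atTop_mul_const hpos).eventually_gt_atTop
    ((‖A‖ * (r + r)) ^ 2) |>.exists
  exact absurd ((hgrow n).trans (hbdd n)) (not_le.2 hn)

variable [FiniteDimensional ℝ E]

/-- `A²` has finitely many eigenvalues, so some `c` in the interval avoids them; an injective linear
map in finite dimension is bounded below. -/
theorem exists_sq_sub_smul_antilipschitz (A : E →L[ℝ] E) {a b : ℝ} (hab : a < b) :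
    ∃ c ∈ Set.Ioo a b, ∃ δ > 0, ∀ w, δ * ‖w‖ ^ 2 ≤ ‖A (A w) - c • w‖ ^ 2 := by
  have hfin := Module.End.finite_hasEigenvalue (A.toLinearMap * A.toLinearMap : Module.End ℝ E)
  obtain ⟨c, hc, hcs⟩ := (Set.Ioo_infinite hab).exists_notMem_finite hfin
  refine ⟨c, hc, ?_⟩
  let B : E →ₗ[ℝ] E := A.toLinearMap * A.toLinearMap - c • LinearMap.id
  have hker : LinearMap.ker B = ⊥ := by
    by_contra hne
    obtain ⟨w, hw, hw0⟩ := Submodule.exists_mem_ne_zero_of_ne_bot hne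
    refine hcs (Module.End.hasEigenvalue_of_hasEigenvector (x := w)
      ⟨Module.End.mem_eigenspace_iff.2 ?_, hw0⟩)
    have : A (A w) - c • w = 0 := hw
    exact sub_eq_zero.1 this
  obtain ⟨K, hK, hB⟩ := B.exists_antilipschitzWith hker
  have hK' : (0 : ℝ) < K := hK
  refine ⟨((K : ℝ)⁻¹) ^ 2, by positivity, fun w => ?_⟩
  have h := hB.le_mul_dist w 0
  rw [map_zero, dist_zero_right, dist_zero_right] at h
  have h' : (K : ℝ)⁻¹ * ‖w‖ ≤ ‖A (A w) - c • w‖ := by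
    rw [inv_mul_le_iff₀ hK']; exact h
  rw [← mul_pow]
  exact pow_le_pow_left₀ (by positivity) h' 2

variable [MeasurableSpace E] [BorelSpace E]

theorem exists_measure_iterate_mem_closedBall_eq_zero (ν : Measure E) [ν.IsAddHaarMeasure]
    {φ : E → E} (hφ : Continuous φ) {A : E →L[ℝ] E} (hA : A.toLinearMap.IsSymmetric) {p : E}
    (hφA : HasStrictFDerivAt φ A p) {v : E} {μ : ℝ} (hv : v ≠ 0) (hAv : A v = μ • v)
    (hμ : 1 < μ ^ 2) :
    ∃ r > 0, ν {θ | ∀ n, φ^[n] θ ∈ Metric.closedBall p r} = 0 := by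
  obtain ⟨c, ⟨hc1, hcμ⟩, δ, hδ, hAδ⟩ := exists_sq_sub_smul_antilipschitz A hμ
  have hC : 0 < 2 * ‖A‖ ^ 3 + 2 * c * ‖A‖ + c := by
    have : 0 < c := by linarith
    positivity
  have hε : 0 < min 1 (δ / (2 * ‖A‖ ^ 3 + 2 * c * ‖A‖ + c)) := lt_min one_pos (div_pos hδ hC)
  obtain ⟨r, hr, hlin⟩ := hφA.exists_ball_norm_sub_le hε
  refine ⟨r / 2, half_pos hr, ?_⟩
  have hsub : Metric.closedBall p (r / 2) ⊆ Metric.ball p r :=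
    Metric.closedBall_subset_ball (half_lt_self hr)
  have hstep : ∀ a ∈ Metric.closedBall p (r / 2), ∀ b ∈ Metric.closedBall p (r / 2),
      c * expansionForm A c (a - b) ≤ expansionForm A c (φ a - φ b) := fun a ha b hb =>
    expansionForm_le_of_norm_sub_le hA (by linarith) hε.le (min_le_left _ _) hAδ
      ((le_div_iff₀ hC).1 (min_le_right _ _)) (hlin a (hsub ha) b (hsub hb))
  have hpos : ∀ t : ℝ, t ≠ 0 → 0 < expansionForm A c (t • v) := by
    intro t ht
    have hv' : 0 < ‖v‖ := norm_pos_iff.2 hv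
    have ht' : 0 < t ^ 2 := by positivity
    have : expansionForm A c (t • v) = t ^ 2 * ((μ ^ 2 - c) * ‖v‖ ^ 2) := by
      simp only [expansionForm, map_smul, hAv, norm_smul, mul_pow, Real.norm_eq_abs, sq_abs]
      ring
    rw [this]
    exact mul_pos ht' (mul_pos (by linarith) (by positivity))
  have hclosed : IsClosed {θ | ∀ n, φ^[n] θ ∈ Metric.closedBall p (r / 2)} := by
    rw [Set.ofPred_forall]
    exact isClosed_iInter fun n => Metric.isClosed_closedBall.preimage (hφ.iterate n)
  -- The vectors `v / (n + 1)` are bounded and differ by nonzero multiples of `v`, on which the form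
  -- is positive.
  refine Measure.addHaar_eq_zero_of_disjoint_translates ν
    (fun n : ℕ => ((n : ℝ) + 1)⁻¹ • v) ?_ ?_ hclosed.measurableSet
  · refine (Metric.isBounded_closedBall (x := (0 : E)) (r := ‖v‖)).subset ?_
    rintro _ ⟨n, rfl⟩
    have h1 : ((n : ℝ) + 1)⁻¹ ≤ 1 := inv_le_one_of_one_le₀ (by linarith [n.cast_nonneg (α := ℝ)])
    have h0 : 0 ≤ ((n : ℝ) + 1)⁻¹ := by positivity
    rw [mem_closedBall_zero_iff, norm_smul, Real.norm_of_nonneg h0]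
    exact mul_le_of_le_one_left (norm_nonneg _) h1
  · intro m n hmn
    refine Set.disjoint_left.2 fun z hzm hzn => ?_
    simp only [Set.singleton_add, Set.image_add_left, Set.mem_preimage, Set.mem_ofPred_eq]
      at hzm hzn
    have h := expansionForm_sub_nonpos_of_iterate_mem_closedBall hc1 hstep hzm hzn
    have heq : -(((m : ℝ) + 1)⁻¹ • v) + z - (-(((n : ℝ) + 1)⁻¹ • v) + z) =
        (((n : ℝ) + 1)⁻¹ - ((m : ℝ) + 1)⁻¹) • v := by
      rw [sub_smul]; abel
    rw [heq] at h
    refine (hpos _ ?_).not_ge h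
    rw [sub_ne_zero]
    intro h'
    exact hmn (by exact_mod_cast (add_right_cancel (inv_injective h')).symm)

end Unstable

/-! ### Contraction of the gradient and convergence to the zero set. -/

section Stable

variable {E : Type*} [NormedAddCommGroup E] [InnerProductSpace ℝ E]

/-- One step of gradient descent contracts the gradient near a point where the set of critical
points has transversal slices. -/
theorem norm_apply_sub_smul_le_of_slice {g : E → E} {H : E →L[ℝ] E} {S : Set E}
    {η κ c ε : ℝ} {N : Submodule ℝ E} (hη : 0 < η) (hκ0 : 0 ≤ κ) (hκ1 : κ ≤ 1) (hc : 0 < c)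
    (hε : 0 < ε) (hεc : ε ≤ c / 2) (hHN : ∀ w, H w ∈ N) (hκ : ∀ w ∈ N, ‖w - η • H w‖ ≤ κ * ‖w‖)
    (hcH : ∀ w ∈ N, c * ‖w‖ ≤ ‖H w‖)
    (hlin : ∀ a ∈ S, ∀ b ∈ S, ‖g a - g b - H (a - b)‖ ≤ ε * ‖a - b‖)
    {θ z : E} (hθ : θ ∈ S) (hz : z ∈ S) (hgz : g z = 0) (hθz : θ - z ∈ N) :
    ‖θ - z‖ ≤ 2 / c * ‖g θ‖ ∧ (θ - η • g θ ∈ S →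
      ‖g (θ - η • g θ)‖ ≤ (κ + ε * ((2 + η * ‖H‖) * (2 / c) + η)) * ‖g θ‖) := by
  have hs := hlin θ hθ z hz
  rw [hgz, sub_zero] at hs
  obtain ⟨s, hgs⟩ : ∃ s, g θ = H (θ - z) + s := ⟨g θ - H (θ - z), by abel⟩
  have hs' : ‖s‖ ≤ ε * ‖θ - z‖ := by simpa [hgs] using hs
  have hcw := hcH _ hθz
  have hHw : ‖H (θ - z)‖ ≤ ‖g θ‖ + ‖s‖ := by
    have : H (θ - z) = g θ - s := by rw [hgs]; abel
    rw [this]; exact norm_sub_le _ _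
  have hle : ‖θ - z‖ ≤ 2 / c * ‖g θ‖ := by
    have h1 := mul_le_mul_of_nonneg_right hεc (norm_nonneg (θ - z))
    have h2 : c / 2 * ‖θ - z‖ ≤ ‖g θ‖ := by linarith
    calc ‖θ - z‖ = 2 / c * (c / 2 * ‖θ - z‖) := by field_simp
      _ ≤ 2 / c * ‖g θ‖ := mul_le_mul_of_nonneg_left h2 (by positivity)
  refine ⟨hle, fun hθ' => ?_⟩
  have hstep := hlin _ hθ' θ hθ
  have hdiff : θ - η • g θ - θ = -(η • g θ) := by abel
  rw [hdiff, norm_neg, norm_smul, Real.norm_of_nonneg hη.le, map_neg, map_smul] at hstep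
  -- The first term is `1 - ηH` applied to `H (θ - z) ∈ N`, hence contracted by `κ`; the other two
  -- are linearization errors, at `θ` and along the step.
  have hdecomp : g (θ - η • g θ) = (H (θ - z) - η • H (H (θ - z))) + (s - η • H s) +
      (g (θ - η • g θ) - g θ - -(η • H (g θ))) := by
    have : H (g θ) = H (H (θ - z)) + H s := by rw [← map_add, ← hgs]
    rw [this, smul_add, eq_sub_of_add_eq' hgs.symm]
    abel
  have h1 : ‖H (θ - z) - η • H (H (θ - z))‖ ≤ κ * (‖g θ‖ + ‖s‖) :=
    (hκ _ (hHN _)).trans (mul_le_mul_of_nonneg_left hHw hκ0)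
  have h2 : ‖s - η • H s‖ ≤ (1 + η * ‖H‖) * ‖s‖ := by
    refine (norm_sub_le _ _).trans ?_
    rw [norm_smul, Real.norm_of_nonneg hη.le]
    have := mul_le_mul_of_nonneg_left (H.le_opNorm s) hη.le
    linarith
  have h3 : ‖s‖ ≤ ε * (2 / c * ‖g θ‖) := hs'.trans (mul_le_mul_of_nonneg_left hle hε.le)
  have h4 : κ * ‖s‖ ≤ 1 * ‖s‖ := mul_le_mul_of_nonneg_right hκ1 (norm_nonneg _)
  have h5 : (2 + η * ‖H‖) * ‖s‖ ≤ (2 + η * ‖H‖) * (ε * (2 / c * ‖g θ‖)) :=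
    mul_le_mul_of_nonneg_left h3 (by positivity)
  rw [hdecomp]
  refine norm_add₃_le.trans ?_
  linarith

/-- Both bounds must be proved together: gradient decay makes the displacements a geometric sum, and
that sum keeps the orbit in the ball where decay is available. -/
theorem norm_apply_iterate_le_of_contracting {g φ : E → E} {p θ : E} {η κ ρ r : ℝ} (hη : 0 < η)
    (hκ0 : 0 ≤ κ) (hκ1 : κ < 1) (hφ : ∀ θ, φ θ = θ - η • g θ)
    (hstep : ∀ θ ∈ Metric.ball p r, φ θ ∈ Metric.ball p r → ‖g (φ θ)‖ ≤ κ * ‖g θ‖)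
    (hθ : ‖θ - p‖ ≤ ρ) (hρ : ρ + η * ‖g θ‖ / (1 - κ) < r) (n : ℕ) :
    ‖g (φ^[n] θ)‖ ≤ κ ^ n * ‖g θ‖ ∧ ‖φ^[n] θ - p‖ ≤ ρ + η * ‖g θ‖ * (1 - κ ^ n) / (1 - κ) := by
  have h1κ : 0 < 1 - κ := by linarith
  have hball : ∀ n z, ‖z - p‖ ≤ ρ + η * ‖g θ‖ * (1 - κ ^ n) / (1 - κ) → z ∈ Metric.ball p r := by
    intro n z hz
    rw [mem_ball_iff_norm]
    have h1 : η * ‖g θ‖ * (1 - κ ^ n) ≤ η * ‖g θ‖ :=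
      mul_le_of_le_one_right (by positivity) (by linarith [pow_nonneg hκ0 n])
    have h2 := div_le_div_of_nonneg_right h1 h1κ.le
    linarith
  induction n with
  | zero => simpa using hθ
  | succ n ih =>
    obtain ⟨ih1, ih2⟩ := ih
    have hdist : ‖φ^[n + 1] θ - p‖ ≤ ρ + η * ‖g θ‖ * (1 - κ ^ (n + 1)) / (1 - κ) := by
      rw [Function.iterate_succ_apply', hφ]
      have : φ^[n] θ - η • g (φ^[n] θ) - p = (φ^[n] θ - p) - η • g (φ^[n] θ) := by abel
      rw [this]
      refine (norm_sub_le _ _).trans ?_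
      rw [norm_smul, Real.norm_of_nonneg hη.le]
      have h1 := mul_le_mul_of_nonneg_left ih1 hη.le
      have h2 : η * ‖g θ‖ * (1 - κ ^ (n + 1)) / (1 - κ) =
          η * ‖g θ‖ * (1 - κ ^ n) / (1 - κ) + η * (κ ^ n * ‖g θ‖) := by
        field_simp
        ring
      linarith
    refine ⟨?_, hdist⟩
    have hmem := hball _ _ hdist
    rw [Function.iterate_succ_apply'] at hmem ⊢
    refine (hstep _ (hball _ _ ih2) hmem).trans ?_
    rw [pow_succ', mul_assoc]
    exact mul_le_mul_of_nonneg_left ih1 hκ0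

theorem eventually_iterate_mem_and_tendsto [CompleteSpace E] {g φ : E → E} {H : E →L[ℝ] E}
    {M : Set E} {p : E} {η κ : ℝ} {N : Submodule ℝ E} (hη : 0 < η) (hκ0 : 0 ≤ κ) (hκ1 : κ < 1)
    (hφ : ∀ θ, φ θ = θ - η • g θ) (hgc : Continuous g) (hgM : ∀ z ∈ M, g z = 0) (hp : p ∈ M)
    (hg : HasStrictFDerivAt g H p) (hHN : ∀ w, H w ∈ N)
    (hκ : ∀ w ∈ N, ‖w - η • H w‖ ≤ κ * ‖w‖)
    (hslice : ∀ W ∈ 𝓝 p, ∀ᶠ θ in 𝓝 p, ∃ z ∈ M ∩ W, θ - z ∈ N) {U : Set E} (hU : U ∈ 𝓝 p) :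
    ∀ᶠ θ in 𝓝 p, (∀ n, φ^[n] θ ∈ U) ∧
      ∃ θ' ∈ M ∩ U, Tendsto (fun n => φ^[n] θ) atTop (𝓝 θ') := by
  have h1κ : 0 < 1 - κ := by linarith
  have hc : 0 < (1 - κ) / η := div_pos h1κ hη
  set c := (1 - κ) / η with hc_def
  have hcH : ∀ w ∈ N, c * ‖w‖ ≤ ‖H w‖ := by
    intro w hw
    have h1 : ‖w‖ - ‖η • H w‖ ≤ ‖w - η • H w‖ := norm_sub_norm_le _ _
    rw [norm_smul, Real.norm_of_nonneg hη.le] at h1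
    have h2 := hκ w hw
    rw [hc_def, div_mul_eq_mul_div, div_le_iff₀ hη]
    linarith
  set K := (2 + η * ‖H‖) * (2 / c) + η with hK_def
  have hK : 0 < K := by positivity
  -- The second bound gives `κ + ε * K ≤ (1 + κ) / 2`, still below 1.
  set ε := min (c / 2) ((1 - κ) / 2 / K)
  have hε : 0 < ε := lt_min (by positivity) (by positivity)
  have hεK : κ + ε * K ≤ (1 + κ) / 2 := by
    have := (le_div_iff₀ hK).1 (min_le_right (c / 2) ((1 - κ) / 2 / K))
    linarith
  obtain ⟨r₀, hr₀, hlin⟩ := hg.exists_ball_norm_sub_le hε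
  obtain ⟨r₁, hr₁, hsl⟩ := Metric.eventually_nhds_iff_ball.1
    (((hslice _ (Metric.ball_mem_nhds p hr₀)).and (Metric.ball_mem_nhds p hr₀)).and hU)
  have hstep : ∀ θ ∈ Metric.ball p r₁, φ θ ∈ Metric.ball p r₁ →
      ‖g (φ θ)‖ ≤ (1 + κ) / 2 * ‖g θ‖ := by
    intro θ hθ hφθ
    obtain ⟨⟨⟨z, ⟨hzM, hz⟩, hθz⟩, hθ₀⟩, -⟩ := hsl θ hθ
    have h := (norm_apply_sub_smul_le_of_slice hη hκ0 hκ1.le hc hε (min_le_left _ _) hHN hκ hcH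
      hlin hθ₀ hz (hgM z hzM) hθz).2
    rw [← hφ] at h
    exact (h (hsl _ hφθ).1.2).trans (mul_le_mul_of_nonneg_right hεK (norm_nonneg _))
  have hκ' : (1 + κ) / 2 < 1 := by linarith
  have hκ'0 : 0 ≤ (1 + κ) / 2 := by linarith
  have hsmall : ∀ᶠ θ in 𝓝 p, r₁ / 2 + η * ‖g θ‖ / (1 - (1 + κ) / 2) < r₁ := by
    have hcont : Continuous fun θ => r₁ / 2 + η * ‖g θ‖ / (1 - (1 + κ) / 2) := by fun_prop
    refine hcont.continuousAt.eventually_lt_const ?_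
    simp [hgM p hp, hr₁]
  filter_upwards [hsmall, Metric.closedBall_mem_nhds p (half_pos hr₁)] with θ hθr hθ
  have hiter := norm_apply_iterate_le_of_contracting hη hκ'0 hκ' hφ hstep
    (mem_closedBall_iff_norm.1 hθ) hθr
  have hdist : ∀ n, ‖φ^[n] θ - p‖ ≤ r₁ / 2 + η * ‖g θ‖ / (1 - (1 + κ) / 2) := by
    intro n
    have h1 : η * ‖g θ‖ * (1 - ((1 + κ) / 2) ^ n) ≤ η * ‖g θ‖ :=
      mul_le_of_le_one_right (by positivity) (by linarith [pow_nonneg hκ'0 n])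
    have h2 := div_le_div_of_nonneg_right h1 (sub_nonneg.2 hκ'.le)
    linarith [(hiter n).2]
  have hmem : ∀ n, φ^[n] θ ∈ Metric.ball p r₁ := fun n =>
    mem_ball_iff_norm.2 ((hdist n).trans_lt hθr)
  have hcauchy : CauchySeq fun n => φ^[n] θ := by
    refine cauchySeq_of_le_geometric ((1 + κ) / 2) (η * ‖g θ‖) hκ' fun n => ?_
    rw [Function.iterate_succ_apply', hφ, dist_eq_norm, sub_sub_cancel, norm_smul,
      Real.norm_of_nonneg hη.le, mul_assoc, mul_comm ‖g θ‖]
    exact mul_le_mul_of_nonneg_left (hiter n).1 hη.le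
  obtain ⟨θ', hθ'⟩ := cauchySeq_tendsto_of_complete hcauchy
  have hθ'mem : θ' ∈ Metric.ball p r₁ :=
    mem_ball_iff_norm.2 ((le_of_tendsto' (hθ'.sub_const p).norm hdist).trans_lt hθr)
  have hgθ' : g θ' = 0 := by
    have h1 : Tendsto (fun n => g (φ^[n] θ)) atTop (𝓝 (g θ')) := (hgc.tendsto θ').comp hθ'
    refine tendsto_nhds_unique h1 (squeeze_zero_norm (fun n => (hiter n).1) ?_)
    simpa using (tendsto_pow_atTop_nhds_zero_of_lt_one hκ'0 hκ').mul_const ‖g θ‖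
  refine ⟨fun n => (hsl _ (hmem n)).2, θ', ⟨?_, (hsl _ hθ'mem).2⟩, hθ'⟩
  -- On a slice `‖θ' - z‖` is controlled by `‖g θ'‖ = 0`, so the limit is the slice's point of `M`.
  obtain ⟨⟨⟨z, ⟨hzM, hz⟩, hθz⟩, hθ₀⟩, -⟩ := hsl θ' hθ'mem
  have h := (norm_apply_sub_smul_le_of_slice hη hκ0 hκ1.le hc hε (min_le_left _ _) hHN hκ hcH
    hlin hθ₀ hz (hgM z hzM) hθz).1
  rw [hgθ', norm_zero, mul_zero, norm_le_zero_iff, sub_eq_zero] at h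
  exact h ▸ hzM

end Stable

/-! ### Spectral radius of a real symmetric map. -/

section Spectral

variable {V : Type*} [NormedAddCommGroup V] [InnerProductSpace ℝ V] [FiniteDimensional ℝ V]

/-- The characteristic polynomial already splits over `ℝ`, so complexifying adds no roots. -/
theorem LinearMap.IsSymmetric.mem_spectrum_baseChange_iff {f : V →ₗ[ℝ] V} (hf : f.IsSymmetric)
    (z : ℂ) : z ∈ spectrum ℂ (f.baseChange ℂ : Module.End ℂ (TensorProduct ℝ ℂ V)) ↔
      ∃ i, z = hf.eigenvalues rfl i := by
  rw [← Module.End.hasEigenvalue_iff_mem_spectrum, Module.End.hasEigenvalue_iff_isRoot_charpoly,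
    LinearMap.charpoly_baseChange, hf.charpoly_eq rfl]
  simp [Polynomial.map_prod, Polynomial.IsRoot, Polynomial.eval_prod, Finset.prod_eq_zero_iff,
    sub_eq_zero]

theorem LinearMap.IsSymmetric.exists_norm_apply_le_of_realSpectralRadius_lt_one {f : V →ₗ[ℝ] V}
    (hf : f.IsSymmetric) (h : realSpectralRadius f < 1) :
    ∃ κ : ℝ, 0 ≤ κ ∧ κ < 1 ∧ ∀ w, ‖f w‖ ≤ κ * ‖w‖ := by
  have hκ1 : (realSpectralRadius f).toReal < 1 := by
    simpa using (ENNReal.toReal_lt_toReal h.ne_top ENNReal.one_ne_top).2 h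
  refine ⟨(realSpectralRadius f).toReal, ENNReal.toReal_nonneg, hκ1, fun w => ?_⟩
  set κ := (realSpectralRadius f).toReal
  have hκ0 : 0 ≤ κ := ENNReal.toReal_nonneg
  have heig : ∀ i, |hf.eigenvalues rfl i| ≤ κ := by
    intro i
    have h1 : ((‖((hf.eigenvalues rfl i : ℝ) : ℂ)‖₊ : NNReal) : ℝ≥0∞) ≤ realSpectralRadius f :=
      le_iSup₂ (f := fun (z : ℂ) (_ : z ∈ spectrum ℂ (f.baseChange ℂ : Module.End ℂ _)) =>
        ((‖z‖₊ : NNReal) : ℝ≥0∞)) _ ((hf.mem_spectrum_baseChange_iff _).2 ⟨i, rfl⟩)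
    simpa using ENNReal.toReal_mono h.ne_top h1
  refine le_of_sq_le_sq ?_ (by positivity)
  rw [mul_pow, ← (hf.eigenvectorBasis rfl).repr.norm_map (f w),
    ← (hf.eigenvectorBasis rfl).repr.norm_map w, EuclideanSpace.norm_sq_eq,
    EuclideanSpace.norm_sq_eq, Finset.mul_sum]
  refine Finset.sum_le_sum fun i _ => ?_
  rw [hf.eigenvectorBasis_apply_self_apply, norm_mul, mul_pow]
  refine mul_le_mul_of_nonneg_right (pow_le_pow_left₀ (norm_nonneg _) ?_ 2) (sq_nonneg _)
  simpa using heig i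

theorem LinearMap.IsSymmetric.exists_eigenvector_of_one_lt_realSpectralRadius {f : V →ₗ[ℝ] V}
    (hf : f.IsSymmetric) (h : 1 < realSpectralRadius f) :
    ∃ μ : ℝ, ∃ v, v ≠ 0 ∧ f v = μ • v ∧ 1 < μ ^ 2 := by
  obtain ⟨z, hz⟩ := lt_iSup_iff.1 h
  obtain ⟨hzs, hz⟩ := lt_iSup_iff.1 hz
  obtain ⟨i, rfl⟩ := (hf.mem_spectrum_baseChange_iff z).1 hzs
  refine ⟨hf.eigenvalues rfl i, hf.eigenvectorBasis rfl i,
    (hf.hasEigenvector_eigenvectorBasis rfl i).2,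
    hf.apply_eigenvectorBasis rfl i, ?_⟩
  have : (1 : ℝ) < |hf.eigenvalues rfl i| := by
    have : (1 : NNReal) < ‖((hf.eigenvalues rfl i : ℝ) : ℂ)‖₊ := by exact_mod_cast hz
    simpa using NNReal.coe_lt_coe.2 this
  rw [← sq_abs]
  exact one_lt_pow₀ this two_ne_zero

end Spectral

/-! ### Slices of a neighborhood by translates of the normal space. -/

section Submanifold

variable {D : ℕ}

/-- The subspace of `ℝ^D` where all but the first `k` coordinates vanish. -/
def coordinateSubspace (D k : ℕ) : Submodule ℝ (EuclideanSpace ℝ (Fin D)) where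
  carrier := {u | ∀ i : Fin D, k ≤ (i : ℕ) → u i = 0}
  add_mem' := fun ha hb i hi => by simp [ha i hi, hb i hi]
  zero_mem' := fun _ _ => rfl
  smul_mem' := fun c a ha i hi => by simp [ha i hi]

theorem HasDerivAt.mem_of_eventually_mem {E : Type*} [NormedAddCommGroup E] [NormedSpace ℝ E]
    [FiniteDimensional ℝ E] {S : Submodule ℝ E} {γ : ℝ → E} {v : E} {t : ℝ}
    (hγ : HasDerivAt γ v t) (hS : ∀ᶠ s in 𝓝 t, γ s ∈ S) : v ∈ S := by
  have hcl : IsClosed (S : Set E) := S.closed_of_finiteDimensional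
  have htends := hasDerivAt_iff_tendsto_slope.1 hγ
  refine hcl.mem_of_tendsto htends ?_
  filter_upwards [nhdsWithin_le_nhds hS] with s hs
  rw [slope_def_module]
  exact S.smul_mem _ (S.sub_mem hs hS.self_of_nhds)

/-- Parametrize `M` by the chart and project orthogonally to the tangent space `T`. The derivative
is onto `T`, so this map is open at the base point and the projection of any nearby `θ` is that of
some `z ∈ M ∩ W`. -/
theorem IsEmbeddedSubmanifold.eventually_exists_sub_mem_normalSpaceAt {k : ℕ}
    {M : Set (EuclideanSpace ℝ (Fin D))} (hM : IsEmbeddedSubmanifold k M)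
    {p : EuclideanSpace ℝ (Fin D)} (hp : p ∈ M) {W : Set (EuclideanSpace ℝ (Fin D))}
    (hW : W ∈ 𝓝 p) : ∀ᶠ θ in 𝓝 p, ∃ z ∈ M ∩ W, θ - z ∈ normalSpaceAt M p := by
  obtain ⟨e, hpe, he, hes, hflat⟩ := hM.2 p hp
  set T := tangentSpaceAt M p
  set S := coordinateSubspace D k
  have hep : e p ∈ e.target := e.map_source hpe
  have hde : HasFDerivAt e (fderiv ℝ e p) p :=
    ((he.contDiffAt (e.open_source.mem_nhds hpe)).differentiableAt one_ne_zero).hasFDerivAt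
  have hdes : HasStrictFDerivAt e.symm (fderiv ℝ e.symm (e p)) (e p) :=
    (hes.contDiffAt (e.open_target.mem_nhds hep)).hasStrictFDerivAt one_ne_zero
  have hinv : ∀ v, fderiv ℝ e.symm (e p) (fderiv ℝ e p v) = v := by
    have h1 : HasFDerivAt (e.symm ∘ e) (fderiv ℝ e.symm (e p) ∘L fderiv ℝ e p) p :=
      hdes.hasFDerivAt.comp p hde
    have h2 : HasFDerivAt (e.symm ∘ e) (ContinuousLinearMap.id ℝ _) p :=
      (hasFDerivAt_id p).congr_of_eventuallyEq (e.eventually_left_inverse hpe)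
    exact fun v => DFunLike.congr_fun (h1.unique h2) v
  have hTS : ∀ v ∈ T, fderiv ℝ e p v ∈ S := by
    have : T ≤ S.comap (fderiv ℝ e p).toLinearMap := by
      refine Submodule.span_le.2 ?_
      rintro v ⟨γ, hγ0, hγM, hγ⟩
      subst hγ0
      refine HasDerivAt.mem_of_eventually_mem (S := S) (hde.comp_hasDerivAt (0 : ℝ) hγ) ?_
      filter_upwards [hγM, hγ.continuousAt.preimage_mem_nhds (e.open_source.mem_nhds hpe)]
        with t ht hts
      exact (hflat _ hts).1 ht
    exact this
  let s₀ : S := ⟨e p, (hflat p hpe).1 hp⟩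
  let F : S → T := fun s => T.orthogonalProjectionOnto (e.symm s)
  have hF : HasStrictFDerivAt F
      (T.orthogonalProjectionOnto ∘L (fderiv ℝ e.symm (e p) ∘L S.subtypeL)) s₀ :=
    T.orthogonalProjectionOnto.hasStrictFDerivAt.comp s₀
      (HasStrictFDerivAt.comp (g := e.symm) s₀ hdes S.subtypeL.hasStrictFDerivAt)
  have hsurj : (T.orthogonalProjectionOnto ∘L
      (fderiv ℝ e.symm (e p) ∘L S.subtypeL)).range = ⊤ := by
    -- Only `De(T) ⊆ S` is needed: `De t` is a preimage of `t`.
    refine LinearMap.range_eq_top.2 fun t => ⟨⟨fderiv ℝ e p t, hTS t t.2⟩, ?_⟩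
    change T.orthogonalProjectionOnto (fderiv ℝ e.symm (e p) (fderiv ℝ e p t)) = t
    rw [hinv, T.orthogonalProjectionOnto_mem_subspace_eq_self]
  have hmap := hF.map_nhds_eq_of_surj hsurj
  have hFs : F s₀ = T.orthogonalProjectionOnto p := by
    change T.orthogonalProjectionOnto (e.symm (e p)) = _
    rw [e.left_inv hpe]
  have hA : {s : S | (s : EuclideanSpace ℝ (Fin D)) ∈ e.target ∧ e.symm s ∈ W} ∈ 𝓝 s₀ := by
    have hsub : ContinuousAt (fun s : S => (s : EuclideanSpace ℝ (Fin D))) s₀ :=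
      continuous_subtype_val.continuousAt
    have hcont : ContinuousAt (fun s : S => e.symm s) s₀ :=
      ContinuousAt.comp (f := fun s : S => (s : EuclideanSpace ℝ (Fin D))) (g := e.symm)
        hdes.continuousAt hsub
    refine (hsub.eventually (e.open_target.mem_nhds hep)).and (hcont.eventually ?_)
    change ∀ᶠ z in 𝓝 (e.symm (e p)), z ∈ W
    rwa [e.left_inv hpe]
  have himg := image_mem_map (m := F) hA
  rw [hmap, hFs] at himg
  filter_upwards [T.orthogonalProjectionOnto.continuous.continuousAt.preimage_mem_nhds himg] with θ hθ
  obtain ⟨s, ⟨hst, hsW⟩, hs⟩ := hθ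
  refine ⟨e.symm s, ⟨?_, hsW⟩, ?_⟩
  · refine (hflat _ (e.map_target hst)).2 fun i hi => ?_
    rw [e.right_inv hst]
    exact s.2 i hi
  · change θ - e.symm s ∈ Tᗮ
    rw [← Submodule.orthogonalProjectionOnto_eq_zero_iff, map_sub, sub_eq_zero]
    exact hs.symm

end Submanifold

/-! ### The Hessian of the loss and the two stability implications. -/

section GradientDescent

variable {D : ℕ} {L : EuclideanSpace ℝ (Fin D) → ℝ}

theorem ContDiff.gradient (hL : ContDiff ℝ 2 L) : ContDiff ℝ 1 (gradient L) :=
  (InnerProductSpace.toDual ℝ (EuclideanSpace ℝ (Fin D))).symm.contDiff.comp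
    (hL.fderiv_right (m := 1) (by norm_num))

theorem gradient_eq_zero_of_nonneg_of_eq_zero (hL0 : ∀ θ, 0 ≤ L θ)
    {z : EuclideanSpace ℝ (Fin D)} (hz : L z = 0) : gradient L z = 0 := by
  have : IsLocalMin L z := Eventually.of_forall fun θ => hz ▸ hL0 θ
  simp [gradient, this.fderiv_eq_zero]

theorem isSymmetric_fderiv_gradient (hL : ContDiff ℝ 2 L) (p : EuclideanSpace ℝ (Fin D)) :
    (fderiv ℝ (gradient L) p).toLinearMap.IsSymmetric := by
  have hd : DifferentiableAt ℝ (fderiv ℝ L) p :=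
    (hL.fderiv_right (m := 1) (by norm_num)).differentiable one_ne_zero p
  have hg : DifferentiableAt ℝ (gradient L) p := hL.gradient.differentiable one_ne_zero p
  have happ : ∀ v w, inner ℝ (fderiv ℝ (gradient L) p v) w = fderiv ℝ (fderiv ℝ L) p v w := by
    intro v w
    have h1 : HasFDerivAt (fun z => innerSL ℝ w (gradient L z))
        (innerSL ℝ w ∘L fderiv ℝ (gradient L) p) p :=
      (innerSL ℝ w).hasFDerivAt.comp p hg.hasFDerivAt
    have h2 : HasFDerivAt (fun z => fderiv ℝ L z w)
        (ContinuousLinearMap.apply ℝ ℝ w ∘L fderiv ℝ (fderiv ℝ L) p) p :=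
      (ContinuousLinearMap.apply ℝ ℝ w).hasFDerivAt.comp p hd.hasFDerivAt
    have heq : (fun z => innerSL ℝ w (gradient L z)) = fun z => fderiv ℝ L z w := by
      funext z
      rw [innerSL_apply_apply, real_inner_comm, inner_gradient_left]
    rw [heq] at h1
    rw [real_inner_comm]
    exact DFunLike.congr_fun (h1.unique h2) v
  intro v w
  change inner ℝ (fderiv ℝ (gradient L) p v) w = inner ℝ v (fderiv ℝ (gradient L) p w)
  rw [happ, real_inner_comm, happ]
  exact (hL.contDiffAt.isSymmSndFDerivAt (by simp)) v w

theorem fderiv_gradient_apply_eq_zero_of_mem_tangentSpaceAt (hL : ContDiff ℝ 2 L)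
    (hL0 : ∀ θ, 0 ≤ L θ) {p v : EuclideanSpace ℝ (Fin D)}
    (hv : v ∈ tangentSpaceAt (interpolationSet L) p) : fderiv ℝ (gradient L) p v = 0 := by
  have hle : tangentSpaceAt (interpolationSet L) p ≤
      LinearMap.ker (fderiv ℝ (gradient L) p).toLinearMap := by
    refine Submodule.span_le.2 ?_
    rintro v ⟨γ, rfl, hγM, hγ⟩
    have hd : HasFDerivAt (gradient L) (fderiv ℝ (gradient L) (γ 0)) (γ 0) :=
      (hL.gradient.differentiable one_ne_zero _).hasFDerivAt
    have h1 := hd.comp_hasDerivAt (0 : ℝ) hγ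
    have h2 : HasDerivAt (gradient L ∘ γ) 0 0 :=
      (hasDerivAt_const (0 : ℝ) (0 : EuclideanSpace ℝ (Fin D))).congr_of_eventuallyEq
        (hγM.mono fun t ht => gradient_eq_zero_of_nonneg_of_eq_zero hL0 ht)
    exact h1.unique h2
  exact hle hv

/-- The range of a symmetric map is orthogonal to its kernel, which contains the tangent space. -/
theorem fderiv_gradient_apply_mem_normalSpaceAt (hL : ContDiff ℝ 2 L)
    (hL0 : ∀ θ, 0 ≤ L θ) (p v : EuclideanSpace ℝ (Fin D)) :
    fderiv ℝ (gradient L) p v ∈ normalSpaceAt (interpolationSet L) p := by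
  refine (Submodule.mem_orthogonal _ _).2 fun t ht => ?_
  have h := isSymmetric_fderiv_gradient hL p t v
  change inner ℝ (fderiv ℝ (gradient L) p t) v = inner ℝ t (fderiv ℝ (gradient L) p v) at h
  rw [← h, fderiv_gradient_apply_eq_zero_of_mem_tangentSpaceAt hL hL0 ht, inner_zero_left]

theorem ContDiff.gradientDescentMap (hL : ContDiff ℝ 2 L) (η : ℝ) :
    ContDiff ℝ 1 (gradientDescentMap η L) :=
  contDiff_id.sub (hL.gradient.const_smul η)

theorem fderiv_gradientDescentMap_apply (hL : ContDiff ℝ 2 L) (η : ℝ)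
    (p v : EuclideanSpace ℝ (Fin D)) :
    fderiv ℝ (gradientDescentMap η L) p v = v - η • fderiv ℝ (gradient L) p v := by
  have h := (hasFDerivAt_id (𝕜 := ℝ) p).sub
    ((hL.gradient.differentiable one_ne_zero p).hasFDerivAt.const_smul η)
  have h' : HasFDerivAt (_root_.gradientDescentMap η L) _ p := h
  rw [h'.fderiv]
  rfl

theorem isSymmetric_fderiv_gradientDescentMap (hL : ContDiff ℝ 2 L) (η : ℝ)
    (p : EuclideanSpace ℝ (Fin D)) :
    (fderiv ℝ (gradientDescentMap η L) p).toLinearMap.IsSymmetric := by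
  intro v w
  have h := isSymmetric_fderiv_gradient hL p v w
  simp only [ContinuousLinearMap.coe_coe] at h ⊢
  rw [fderiv_gradientDescentMap_apply hL, fderiv_gradientDescentMap_apply hL, inner_sub_left,
    inner_sub_right, real_inner_smul_left, real_inner_smul_right, h]

theorem fderiv_gradientDescentMap_apply_mem_normalSpaceAt (hL : ContDiff ℝ 2 L)
    (hL0 : ∀ θ, 0 ≤ L θ) (η : ℝ) (p : EuclideanSpace ℝ (Fin D)) :
    ∀ v ∈ normalSpaceAt (interpolationSet L) p,
      (fderiv ℝ (gradientDescentMap η L) p).toLinearMap v ∈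
        normalSpaceAt (interpolationSet L) p := by
  intro v hv
  rw [ContinuousLinearMap.coe_coe, fderiv_gradientDescentMap_apply hL]
  exact Submodule.sub_mem _ hv
    (Submodule.smul_mem _ _ (fderiv_gradient_apply_mem_normalSpaceAt hL hL0 p v))

theorem isLocallyStable_of_realSpectralRadius_lt_one (hL : ContDiff ℝ 2 L) (hL0 : ∀ θ, 0 ≤ L θ)
    {k : ℕ} (hM : IsEmbeddedSubmanifold k (interpolationSet L)) {η : ℝ} (hη : 0 < η)
    (θ : interpolationSet L)
    (hinv : ∀ v ∈ normalSpaceAt (interpolationSet L) θ,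
      (fderiv ℝ (gradientDescentMap η L) θ).toLinearMap v ∈ normalSpaceAt (interpolationSet L) θ)
    (h : realSpectralRadius
      ((fderiv ℝ (gradientDescentMap η L) θ).toLinearMap.restrict hinv) < 1) :
    IsLocallyStable (gradientDescentMap η L) (interpolationSet L) θ := by
  obtain ⟨κ, hκ0, hκ1, hκ⟩ :=
    ((isSymmetric_fderiv_gradientDescentMap hL η θ).restrict_invariant
      hinv).exists_norm_apply_le_of_realSpectralRadius_lt_one h
  intro U hU hθU V hV hθV
  obtain ⟨V', hV', rfl⟩ := isOpen_induced_iff.1 hV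
  have hev := eventually_iterate_mem_and_tendsto (φ := gradientDescentMap η L)
    (p := (θ : EuclideanSpace ℝ (Fin D))) hη hκ0 hκ1 (fun _ => rfl) hL.gradient.continuous
    (fun z hz => gradient_eq_zero_of_nonneg_of_eq_zero hL0 hz) θ.2
    (hL.gradient.contDiffAt.hasStrictFDerivAt one_ne_zero)
    (fderiv_gradient_apply_mem_normalSpaceAt hL hL0 θ)
    (fun w hw => by
      rw [← fderiv_gradientDescentMap_apply hL]
      exact hκ ⟨w, hw⟩)
    (fun W hW => hM.eventually_exists_sub_mem_normalSpaceAt θ.2 hW)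
    -- Intersecting with `V'` also forces the limit into `V`.
    (U := U ∩ V') ((hU.inter hV').mem_nhds ⟨hθU, hθV⟩)
  refine Measure.measure_pos_of_mem_nhds volume (x := (θ : EuclideanSpace ℝ (Fin D))) ?_
  filter_upwards [hev] with z hz
  obtain ⟨hzU, θ', ⟨hθ'M, -, hθ'V⟩, hlim⟩ := hz
  exact ⟨fun n => (hzU n).1, ⟨θ', hθ'M⟩, hθ'V, hlim⟩

theorem realSpectralRadius_le_one_of_isLocallyStable (hL : ContDiff ℝ 2 L) {η : ℝ}
    (θ : interpolationSet L)
    (hinv : ∀ v ∈ normalSpaceAt (interpolationSet L) θ,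
      (fderiv ℝ (gradientDescentMap η L) θ).toLinearMap v ∈ normalSpaceAt (interpolationSet L) θ)
    (h : IsLocallyStable (gradientDescentMap η L) (interpolationSet L) θ) :
    realSpectralRadius
      ((fderiv ℝ (gradientDescentMap η L) θ).toLinearMap.restrict hinv) ≤ 1 := by
  by_contra! hlt
  have hsymm := isSymmetric_fderiv_gradientDescentMap hL η θ
  obtain ⟨μ, v, hv, hAv, hμ⟩ :=
    (hsymm.restrict_invariant hinv).exists_eigenvector_of_one_lt_realSpectralRadius hlt
  have hsmooth := hL.gradientDescentMap η
  obtain ⟨r, hr, hnull⟩ := exists_measure_iterate_mem_closedBall_eq_zero volume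
    hsmooth.continuous hsymm (hsmooth.contDiffAt.hasStrictFDerivAt one_ne_zero)
    (v := (v : EuclideanSpace ℝ (Fin D))) (by simpa using hv) (congrArg Subtype.val hAv) hμ
  -- Staying in the ball is already a null event, so convergence plays no role and `V` may be
  -- everything.
  refine (h (Metric.ball θ r) Metric.isOpen_ball (Metric.mem_ball_self hr) Set.univ isOpen_univ
    trivial).ne' (measure_mono_null ?_ hnull)
  exact fun z hz n => Metric.ball_subset_closedBall (hz.1 n)

end GradientDescent

theorem empiricalLoss_nonneg {D d q N : ℕ}
    (Φ : EuclideanSpace ℝ (Fin D) → EuclideanSpace ℝ (Fin d) → EuclideanSpace ℝ (Fin q))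
    {ℓ : EuclideanSpace ℝ (Fin q) → EuclideanSpace ℝ (Fin q) → ℝ}
    (hℓ : ∀ y' y, 0 ≤ ℓ y' y) (x : Fin N → EuclideanSpace ℝ (Fin d))
    (y : Fin N → EuclideanSpace ℝ (Fin q)) (θ : EuclideanSpace ℝ (Fin D)) :
    0 ≤ empiricalLoss Φ ℓ x y θ :=
  mul_nonneg (by positivity) (Finset.sum_nonneg fun _ _ => hℓ _ _)

theorem mainTheorem6 {D d q N : ℕ} (hN : 0 < N) (hD : q * N < D)
    (Φ : EuclideanSpace ℝ (Fin D) → EuclideanSpace ℝ (Fin d) → EuclideanSpace ℝ (Fin q))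
    (ℓ : EuclideanSpace ℝ (Fin q) → EuclideanSpace ℝ (Fin q) → ℝ)
    (hℓ_nonneg : ∀ y' y, 0 ≤ ℓ y' y) (hℓ_zero : ∀ y' y, ℓ y' y = 0 ↔ y' = y)
    (x : Fin N → EuclideanSpace ℝ (Fin d)) (y : Fin N → EuclideanSpace ℝ (Fin q))
    (hL : ContDiff ℝ 2 (empiricalLoss Φ ℓ x y))
    (hM : IsEmbeddedSubmanifold (D - q * N) (interpolationSet (empiricalLoss Φ ℓ x y)))
    (η : ℝ) (hη : 0 < η)
    (θ : interpolationSet (empiricalLoss Φ ℓ x y)) :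
    ∃ hinv : ∀ v ∈ normalSpaceAt (interpolationSet (empiricalLoss Φ ℓ x y)) θ,
        (fderiv ℝ (gradientDescentMap η (empiricalLoss Φ ℓ x y)) θ).toLinearMap v ∈
          normalSpaceAt (interpolationSet (empiricalLoss Φ ℓ x y)) θ,
      (realSpectralRadius
          ((fderiv ℝ (gradientDescentMap η (empiricalLoss Φ ℓ x y)) θ).toLinearMap.restrict hinv) < 1 →
        IsLocallyStable (gradientDescentMap η (empiricalLoss Φ ℓ x y))
          (interpolationSet (empiricalLoss Φ ℓ x y)) θ) ∧
      (IsLocallyStable (gradientDescentMap η (empiricalLoss Φ ℓ x y))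
          (interpolationSet (empiricalLoss Φ ℓ x y)) θ →
        realSpectralRadius
          ((fderiv ℝ (gradientDescentMap η (empiricalLoss Φ ℓ x y)) θ).toLinearMap.restrict hinv) ≤ 1) := by
  have hL0 := empiricalLoss_nonneg Φ hℓ_nonneg x y
  have hinv := fderiv_gradientDescentMap_apply_mem_normalSpaceAt hL hL0 η θ
  exact ⟨hinv, isLocallyStable_of_realSpectralRadius_lt_one hL hL0 hM hη θ hinv,
    realSpectralRadius_le_one_of_isLocallyStable hL θ hinv⟩
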